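/- **Setting.** Let $G=(V,E)$ be a directed probabilistic social graph with $n=|V|\ge 2$ nodes, $m=|E|$ edges and propagation probabilities $p(e)\in(0,1]$. A random realization of $G$ keeps each edge $e$ independently with probability $p(e)$. $\mathbb E[I_G(S)]$ is the expected number of nodes reachable from $S$ in it, and $v^\circ\in V$ is a node that maximizes $\mathbb E[I_G(\{v\})]$. An RR set of $G$ is the set of nodes that can reach a uniformly random root in a random realization of $G$. For a list $\mathcal R$ of RR sets, $\mathrm{Cov}_{\mathcal R}(S)$ is the number of sets in $\mathcal R$ that meet $S$, and $\mathrm{Cov}_{\mathcal R}(u\mid S)=\mathrm{Cov}_{\mathcal R}(S\cup\{u\})-\mathrm{Cov}_{\mathcal R}(S)$. **Algorithm HATP.** Input: $G$; distinct target nodes $T=\{u_1,\dots,u_k\}\subseteq V$, $k\ge1$, in any order; real costs $c(u)$; a threshold $\varepsilon\in(0,1)$; an initial relative error $\varepsilon_0\in[\varepsilon,1]$; an initial additive error $\zeta_0$, which may depend on the number $n_i$ of nodes of the current residual graph and satisfies $1/n_i\le\zeta_0\le1$. A realization $\phi$ of $G$ is drawn and hidden from the algorithm. Start with $S=\emptyset$,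 $T=\{u_1,\dots,u_k\}$, $G_1=G$. For $i=1,\dots,k$: if $u_i$ is no longer in $G_i$ (it has been activated), remove $u_i$ from $T$ and put $G_{i+1}=G_i$. Otherwise let $n_i,m_i$ be the numbers of nodes and edges of $G_i$, set $\varepsilon_i=\varepsilon_0$, $\zeta_i=\zeta_0$, $\delta_i=1/(kn)$ and repeat the following round: 1. Let $\theta=\big\lceil\frac{(1+\varepsilon_i/3)^2}{2\varepsilon_i\zeta_i}\ln\frac4{\delta_i}\big\rceil$, generate two independent lists $\mathcal R_1,\mathcal R_2$ of $\theta$ independent RR sets of $G_i$ each, and let $f=\mathrm{Cov}_{\mathcal R_1}(u_i\mid S)\frac{n_i}{\theta}$, $r=\mathrm{Cov}_{\mathcal R_2}(u_i\mid T\setminus\{u_i\})\frac{n_i}{\theta}$. 2. If $C_1'$ or $C_2'$ holds: if $f+r\ge 2c(u_i)$, add $u_i$ to $S$, observe the nodes that $u_i$ activates in $G_i$ under $\phi$, and delete them from $G_i$ to get $G_{i+1}$; otherwise remove $u_i$ from $T$ and put $G_{i+1}=G_i$. In both cases go on to $i+1$. Here $C_1'$ is $$\tfrac{f+r-2n_i\zeta_i}{1+\varepsilon}\ge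 2c(u_i)\ \vee\ \tfrac{r-n_i\zeta_i}{1+\varepsilon}\ge c(u_i)\ \vee\ \tfrac{f+r+2n_i\zeta_i}{1-\varepsilon}\le 2c(u_i)\ \vee\ \tfrac{f+n_i\zeta_i}{1-\varepsilon}\le c(u_i),$$ and $C_2'$ is $\varepsilon_i\le\varepsilon\wedge n_i\zeta_i\le1$. 3. Otherwise, apply the first case that fits: if $\varepsilon_i\le\varepsilon$ and $n_i\zeta_i>1$, halve $\zeta_i$; if $\varepsilon_i>\varepsilon$ and $n_i\zeta_i\le1$, halve $\varepsilon_i$; if $f\ge10n_i\zeta_i$, halve $\varepsilon_i$; if $f\le n_i\zeta_i$, halve $\zeta_i$; else divide both by $\sqrt2$. Then halve $\delta_i$. Return $S$. **Running time.** Initialization costs $n+m$; the head of each iteration of the for-loop, the return, and each round cost $1$; each RR set $R$ of $G_i$ costs $2|R|$ plus the number of edges of $G_i$ that point into $R$ (nodes visited and edges examined by the reverse search, and one scan of $R$ for the coverage); rebuilding the graph after a selection costs $n_i+m_i$. The expectation is over $\phi$ and the internal randomness of HATP. **Theorem.** For every $a$ there is a constant $C$, depending only on $a$, such that on all inputs as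 above with $n\le a\,m$ the expected running time of HATP is at most $$C\cdot\frac{k\,m\,\mathbb E[I_G(\{v^\circ\})]}{\varepsilon}\,\ln\frac n\varepsilon .$$ That is, for graphs with $n=O(m)$ (in particular, with $n \le 2m$, for graphs without isolated nodes), the expected running time of HATP is $O\big(\frac{k\,m\,\mathbb E[I(\{v^\circ\})]}{\varepsilon}\ln\frac n\varepsilon\big)$. -/

import Mathlib

universe u

noncomputable section

namespace HATP

/-- A finite probabilistic social graph: directed edges between nodes, and each edge `e` has a
propagation probability `p e ∈ (0, 1]` (independent cascade model). -/
structure ProbGraph (V : Type u) where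
  nodes : Finset V
  edges : Finset (V × V)
  edges_mem : ∀ e ∈ edges, e.1 ∈ nodes ∧ e.2 ∈ nodes
  p : V × V → ℝ
  p_pos : ∀ e ∈ edges, 0 < p e
  p_le_one : ∀ e ∈ edges, p e ≤ 1

namespace ProbGraph

variable {V : Type u}

open scoped Classical in
/-- The residual graph obtained by deleting the nodes in `A` and all edges incident to them. -/
def remove (G : ProbGraph V) (A : Finset V) : ProbGraph V where
  nodes := G.nodes \ A
  edges := G.edges.filter fun e => e.1 ∉ A ∧ e.2 ∉ A
  edges_mem := by
    intro e he
    rw [Finset.mem_filter] at he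
    have h := G.edges_mem e he.1
    exact ⟨Finset.mem_sdiff.2 ⟨h.1, he.2.1⟩, Finset.mem_sdiff.2 ⟨h.2, he.2.2⟩⟩
  p := G.p
  p_pos := fun e he => G.p_pos e (Finset.mem_filter.1 he).1
  p_le_one := fun e he => G.p_le_one e (Finset.mem_filter.1 he).1

/-- `v` can be reached from `w` along edges of the realization `φ` (a set of live edges). -/
def Reach (φ : Finset (V × V)) (w v : V) : Prop :=
  Relation.ReflTransGen (fun a b => (a, b) ∈ φ) w v

open scoped Classical in
/-- The probability `p(φ)` of the realization `φ ⊆ E`: every edge `e` is kept independently with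
probability `p e`. -/
def realizationProb (G : ProbGraph V) (φ : Finset (V × V)) : ℝ :=
  (∏ e ∈ φ, G.p e) * ∏ e ∈ G.edges \ φ, (1 - G.p e)

theorem realizationProb_nonneg (G : ProbGraph V) {φ : Finset (V × V)} (h : φ ⊆ G.edges) :
    0 ≤ G.realizationProb φ := by
  classical
  refine mul_nonneg (Finset.prod_nonneg fun e he => (G.p_pos e (h he)).le)
    (Finset.prod_nonneg fun e he => ?_)
  have := G.p_le_one e (Finset.mem_sdiff.1 he).1
  linarith

theorem sum_realizationProb (G : ProbGraph V) :
    ∑ φ ∈ G.edges.powerset, G.realizationProb φ = 1 := by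
  classical
  have h := Finset.prod_add (fun e => G.p e) (fun e => 1 - G.p e) G.edges
  simp only [add_sub_cancel, Finset.prod_const_one] at h
  rw [h]
  refine Finset.sum_congr rfl fun φ _ => ?_
  unfold realizationProb
  congr!

open scoped Classical in
/-- The law of a random realization of `G`, on the space of all `2 ^ m` edge subsets. -/
def realization (G : ProbGraph V) : PMF (Finset (V × V)) :=
  PMF.ofFinset (fun φ => if φ ⊆ G.edges then ENNReal.ofReal (G.realizationProb φ) else 0)
    G.edges.powerset
    (by
      rw [Finset.sum_congr rfl (g := fun φ => ENNReal.ofReal (G.realizationProb φ))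
        (fun φ hφ => if_pos (Finset.mem_powerset.1 hφ)),
        ← ENNReal.ofReal_sum_of_nonneg
          (fun φ hφ => G.realizationProb_nonneg (Finset.mem_powerset.1 hφ)),
        G.sum_realizationProb, ENNReal.ofReal_one])
    (fun φ hφ => if_neg fun h => hφ (Finset.mem_powerset.2 h))

open scoped Classical in
/-- The nodes of `G` that the seed set `S` activates under the realization `φ`. -/
def activated (G : ProbGraph V) (φ : Finset (V × V)) (S : Finset V) : Finset V :=
  G.nodes.filter fun v => ∃ s ∈ S, Reach φ s v

/-- The expected spread `E[I_G(S)] = ∑_φ I_φ(S) p(φ)`. -/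
def expectedSpread (G : ProbGraph V) (S : Finset V) : ℝ :=
  ∑ φ ∈ G.edges.powerset, ((G.activated φ S).card : ℝ) * G.realizationProb φ

open scoped Classical in
/-- A random RR (reverse reachable) set of `G`: the nodes that can reach a uniformly random root
in a random realization. (The value for a graph without nodes is never used.) -/
def rrSet (G : ProbGraph V) : PMF (Finset V) :=
  if h : G.nodes.Nonempty then
    (PMF.uniformOfFinset G.nodes h).bind fun r =>
      G.realization.map fun φ => G.nodes.filter fun v => Reach φ v r
  else PMF.pure ∅

/-- `θ` independent random RR sets of `G`. -/
def rrSets (G : ProbGraph V) : ℕ → PMF (List (Finset V))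
  | 0 => PMF.pure []
  | θ + 1 => G.rrSet.bind fun R => (G.rrSets θ).map fun L => R :: L

open scoped Classical in
/-- The width of `R`: the number of edges of `G` that point to a node of `R`. -/
def width (G : ProbGraph V) (R : Finset V) : ℕ :=
  (G.edges.filter fun e => e.2 ∈ R).card

/-- The time spent on one RR set `R`. Generating `R` by a reverse breadth-first search from the
root visits every node of `R` once, and tosses one coin for every edge of `G` pointing to a node of
`R`; computing coverages then scans the nodes of `R` once more. -/
def rrTime (G : ProbGraph V) (R : Finset V) : ℕ :=
  (R.card + G.width R) + R.card

end ProbGraph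

open scoped Classical in
/-- `Cov_L(S)`: the number of RR sets in `L` that overlap `S`. -/
def cov {V : Type u} (L : List (Finset V)) (S : Finset V) : ℕ :=
  L.countP fun R => decide (∃ v ∈ R, v ∈ S)

open scoped Classical in
/-- The marginal coverage `Cov_L(v | S) = Cov_L(S ∪ {v}) - Cov_L(S)`. -/
def marginalCov {V : Type u} (L : List (Finset V)) (v : V) (S : Finset V) : ℝ :=
  (cov L (insert v S) : ℝ) - (cov L S : ℝ)

/-- An input of the algorithm: the graph, the target nodes `u₁, …, u_k` in the order in which they
are examined, the seeding costs, the threshold `ε` of the relative error, the initial relative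
error `ε₀`, and the initial additive error `ζ₀ ν` that is used when the residual graph has `ν`
nodes. -/
structure Input (V : Type u) where
  graph : ProbGraph V
  targets : List V
  c : V → ℝ
  ε : ℝ
  ε₀ : ℝ
  ζ₀ : ℕ → ℝ

/-- The configurations of a run. `next G S T us`: the `for` loop is about to treat the remaining
targets `us`, with residual graph `G`, seed set `S` and candidate set `T`. `round G S T v us εi ζi δi`:
the algorithm is about to execute the body of the `while` loop for the target `v`. `done S`: it has
returned `S`. -/
inductive Config (V : Type u) where
  | next (G : ProbGraph V) (S T : Finset V) (us : List V) : Config V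
  | round (G : ProbGraph V) (S T : Finset V) (v : V) (us : List V) (εi ζi δi : ℝ) : Config V
  | done (S : Finset V) : Config V

namespace Input

variable {V : Type u}

/-- The number `n` of nodes of the input graph. -/
def n (I : Input V) : ℕ := I.graph.nodes.card

/-- The number `m` of edges of the input graph. -/
def m (I : Input V) : ℕ := I.graph.edges.card

/-- The number `k` of target nodes. -/
def k (I : Input V) : ℕ := I.targets.length

/-- The number `θ` of RR sets generated for each of the two collections in one round. -/
def sampleSize (εi ζi δi : ℝ) : ℕ :=
  ⌈(1 + εi / 3) ^ 2 / (2 * εi * ζi) * Real.log (4 / δi)⌉₊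

/-- The stopping condition `C₁'`, where `η = n_i ζ_i` and `cv` is the cost of the node. -/
def stop₁ (I : Input V) (f r η cv : ℝ) : Prop :=
  2 * cv ≤ (f + r - 2 * η) / (1 + I.ε) ∨ cv ≤ (r - η) / (1 + I.ε) ∨
    (f + r + 2 * η) / (1 - I.ε) ≤ 2 * cv ∨ (f + η) / (1 - I.ε) ≤ cv

/-- The stopping condition `C₂'`, where `η = n_i ζ_i`. -/
def stop₂ (I : Input V) (εi η : ℝ) : Prop :=
  εi ≤ I.ε ∧ η ≤ 1

open scoped Classical in
/-- The adjustment of the errors `(ε_i, ζ_i)` at the end of an inconclusive round; `f` is the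
estimate `f_est`, and `ni` is the number of nodes of the residual graph. -/
def adjust (I : Input V) (ni : ℕ) (f εi ζi : ℝ) : ℝ × ℝ :=
  if εi ≤ I.ε ∧ 1 < ni * ζi then (εi, ζi / 2)
  else if I.ε < εi ∧ ni * ζi ≤ 1 then (εi / 2, ζi)
  else if 10 * (ni * ζi) ≤ f then (εi / 2, ζi)
  else if f ≤ ni * ζi then (εi, ζi / 2)
  else (εi / √2, ζi / √2)

open scoped Classical in
/-- The part of a round that follows the sampling of the collections `R₁` and `R₂` of `θ` RR sets
each: the next configuration, together with the time of the whole round. The time is one unit for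
the arithmetic and the tests, the time spent on the RR sets and, if the node is selected, the time
for rebuilding the residual graph from its `n_i` nodes and `m_i` edges. The hidden realization `φ`
is only used for observing the nodes activated by a selected node. -/
def finishRound (I : Input V) (φ : Finset (V × V)) (G : ProbGraph V) (S T : Finset V) (v : V)
    (us : List V) (εi ζi δi : ℝ) (θ : ℕ) (R₁ R₂ : List (Finset V)) : Config V × ℕ :=
  let f : ℝ := marginalCov R₁ v S * (G.nodes.card / θ)
  let r : ℝ := marginalCov R₂ v (T.erase v) * (G.nodes.card / θ)
  let η : ℝ := G.nodes.card * ζi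
  let time : ℕ := 1 + ((R₁ ++ R₂).map G.rrTime).sum
  if I.stop₁ f r η (I.c v) ∨ I.stop₂ εi η then
    if 2 * I.c v ≤ f + r then
      (.next (G.remove (G.activated (φ ∩ G.edges) {v})) (insert v S) T us,
        time + (G.nodes.card + G.edges.card))
    else (.next G S (T.erase v) us, time)
  else
    let e := I.adjust G.nodes.card f εi ζi
    (.round G S T v us e.1 e.2 (δi / 2), time)

open scoped Classical in
/-- One step of the algorithm HATP under the hidden realization `φ`: the joint law of the next
configuration and of the time of the step. A step is either one round of the `while` loop or the
head of one iteration of the `for` loop (where a node has been activated exactly if it is no longer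
in the residual graph). -/
def step (I : Input V) (φ : Finset (V × V)) : Config V → PMF (Config V × ℕ)
  | .done S => PMF.pure (.done S, 0)
  | .next _ S _ [] => PMF.pure (.done S, 1)
  | .next G S T (v :: us) =>
      if v ∉ G.nodes then PMF.pure (.next G S (T.erase v) us, 1)
      else PMF.pure (.round G S T v us I.ε₀ (I.ζ₀ G.nodes.card) (1 / (I.k * I.n)), 1)
  | .round G S T v us εi ζi δi =>
      let θ := sampleSize εi ζi δi
      (G.rrSets θ).bind fun R₁ =>
        (G.rrSets θ).map fun R₂ => I.finishRound φ G S T v us εi ζi δi θ R₁ R₂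

/-- The expected time of the first `t` steps from a configuration, over the internal randomness. -/
def expectedTimeUpTo (I : Input V) (φ : Finset (V × V)) : ℕ → Config V → ENNReal
  | 0, _ => 0
  | t + 1, x => ∑' y : Config V × ℕ,
      I.step φ x y * ((y.2 : ENNReal) + I.expectedTimeUpTo φ t y.1)

open scoped Classical in
/-- The initial configuration. -/
def start (I : Input V) : Config V :=
  .next I.graph ∅ I.targets.toFinset I.targets

/-- The expected running time of HATP, over the realization of the network and the internal
randomness: `n + m` for setting up the data structures of the input graph, and the expected time of
all steps until the algorithm returns. It is `∞` if the algorithm runs forever with positive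
probability, since every step of an algorithm that has not returned takes time at least `1`. -/
def expectedTime (I : Input V) : ENNReal :=
  ((I.n + I.m : ℕ) : ENNReal) +
    ∑' φ : Finset (V × V), I.graph.realization φ * ⨆ t : ℕ, I.expectedTimeUpTo φ t I.start

end Input

end HATP

end

open scoped ENNReal

namespace HATP

/-! ### Expectations of `ℝ≥0∞`-valued functions under a `PMF`. -/

section Expectation

variable {α β : Type*}

/-! No concentration inequality is needed: the running time is controlled by the error schedule
alone, and `C₁'` can only end an iteration earlier. Let `x = εi * ζi` on a residual graph with `ν`
nodes. Every inconclusive round halves `x`, while `εi > ε / 2` and `ν * ζi > 1 / 2` persist because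
an error is reduced only above its threshold (`RoundInvariant.adjust`). Hence `1 / x < 4 * ν / ε`
throughout.

A round draws at most `2 * (L + 1) / x` RR sets, where `L = logBound`
(`RoundInvariant.sampleSize_le`). By exchanging sums, an RR set costs on average at most `(2n + m) *
σ / ν`, where `σ` is the largest expected spread in the input graph; passing to a residual graph
does not increase spreads (`Subgraph.tsum_rrSet_mul_rrTime_le`). The costs grow geometrically from
round to round, so their sum is of the order of the largest possible one, and the factor `ν` from `1
/ x` cancels the `1 / ν` of the RR set: one target costs `O((n + m) * σ * L / ε)`.

The geometric sum is hidden in the potential `roundBound`, which contains `8 * ν / ε - 1 / x`: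
halving `x` lowers it by a multiple of `1 / x`, and this pays for the round (`expectedTimeUpTo_le`).
The bound holds for each fixed realization and all residual graphs, so the dependence of the
residual graph on earlier observations is harmless. -/

theorem tsum_bind_mul (p : PMF α) (q : α → PMF β) (f : β → ℝ≥0∞) :
    ∑' y, p.bind q y * f y = ∑' x, p x * ∑' y, q x y * f y := by
  simp only [PMF.bind_apply, ← ENNReal.tsum_mul_right, ← ENNReal.tsum_mul_left]
  rw [ENNReal.tsum_comm]
  simp only [mul_assoc]

theorem tsum_pure_mul (a : α) (f : α → ℝ≥0∞) : ∑' y, PMF.pure a y * f y = f a := by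
  rw [tsum_eq_single a]
  · simp
  · intro b hb
    simp [hb]

theorem tsum_map_mul (p : PMF α) (g : α → β) (f : β → ℝ≥0∞) :
    ∑' y, p.map g y * f y = ∑' x, p x * f (g x) := by
  rw [PMF.map, tsum_bind_mul]
  simp only [Function.comp_apply, tsum_pure_mul]

theorem tsum_mul_const (p : PMF α) (c : ℝ≥0∞) : ∑' x, p x * c = c := by
  rw [ENNReal.tsum_mul_right, p.tsum_coe, one_mul]

theorem tsum_mul_add (p : PMF α) (f g : α → ℝ≥0∞) :
    ∑' x, p x * (f x + g x) = ∑' x, p x * f x + ∑' x, p x * g x := by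
  simp only [mul_add]
  exact ENNReal.tsum_add

theorem tsum_mul_mono (p : PMF α) {f g : α → ℝ≥0∞} (h : ∀ x, f x ≤ g x) :
    ∑' x, p x * f x ≤ ∑' x, p x * g x :=
  ENNReal.tsum_le_tsum fun x => mul_le_mul_right (h x) _

end Expectation

/-! ### Monotonicity in the edge set. -/

/-- Conditioning on the new element `a`: the difference of the two sides is the sum over `φ ⊆ F` of
`p a * (g (insert a φ) - g φ)` times the weight of `φ`. -/
theorem sum_powerset_le_insert {α : Type*} [DecidableEq α] (p : α → ℝ) (g : Finset α → ℝ)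
    (hg : Monotone g) {F : Finset α} {a : α} (h0 : ∀ e ∈ insert a F, 0 ≤ p e)
    (h1 : ∀ e ∈ insert a F, p e ≤ 1) :
    ∑ φ ∈ F.powerset, g φ * ((∏ e ∈ φ, p e) * ∏ e ∈ F \ φ, (1 - p e)) ≤
      ∑ φ ∈ (insert a F).powerset,
        g φ * ((∏ e ∈ φ, p e) * ∏ e ∈ insert a F \ φ, (1 - p e)) := by
  by_cases ha : a ∈ F
  · rw [Finset.insert_eq_of_mem ha]
  rw [Finset.sum_powerset_insert ha, ← Finset.sum_add_distrib]
  refine Finset.sum_le_sum fun φ hφ => ?_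
  have hφF := Finset.mem_powerset.1 hφ
  have haφ : a ∉ φ := fun h => ha (hφF h)
  rw [Finset.insert_sdiff_of_notMem _ haφ, Finset.prod_insert (by simp [ha]),
    Finset.prod_insert haφ, Finset.insert_sdiff_insert, Finset.sdiff_insert_of_notMem ha]
  have hp := h0 a (Finset.mem_insert_self a F)
  have hw : 0 ≤ (∏ e ∈ φ, p e) * ∏ e ∈ F \ φ, (1 - p e) := by
    refine mul_nonneg (Finset.prod_nonneg fun e he =>
      h0 e (Finset.mem_insert_of_mem (hφF he))) (Finset.prod_nonneg fun e he => ?_)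
    have := h1 e (Finset.mem_insert_of_mem (Finset.mem_sdiff.1 he).1)
    linarith
  have hm : g φ ≤ g (insert a φ) := hg (Finset.subset_insert a φ)
  nlinarith [mul_nonneg (mul_nonneg hp hw) (sub_nonneg.2 hm)]

/-- The expectation of a monotone function of a random subset that keeps the elements
independently grows with the ground set. -/
theorem sum_powerset_mono {α : Type*} [DecidableEq α] (p : α → ℝ) (g : Finset α → ℝ)
    (hg : Monotone g) {E F : Finset α} (hEF : E ⊆ F) (h0 : ∀ e ∈ F, 0 ≤ p e)
    (h1 : ∀ e ∈ F, p e ≤ 1) :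
    ∑ φ ∈ E.powerset, g φ * ((∏ e ∈ φ, p e) * ∏ e ∈ E \ φ, (1 - p e)) ≤
      ∑ φ ∈ F.powerset, g φ * ((∏ e ∈ φ, p e) * ∏ e ∈ F \ φ, (1 - p e)) := by
  -- The ground set grows from `E` to `F` one element at a time; `D` collects the elements already
  -- added.
  have key : ∀ D : Finset α, D ⊆ F →
      ∑ φ ∈ E.powerset, g φ * ((∏ e ∈ φ, p e) * ∏ e ∈ E \ φ, (1 - p e)) ≤
        ∑ φ ∈ (D ∪ E).powerset, g φ * ((∏ e ∈ φ, p e) * ∏ e ∈ (D ∪ E) \ φ, (1 - p e)) := by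
    intro D
    induction D using Finset.induction_on with
    | empty => simp
    | insert a D _ ih =>
      intro hD
      have hsub : insert a (D ∪ E) ⊆ F := by
        rw [← Finset.insert_union]
        exact Finset.union_subset hD hEF
      rw [Finset.insert_union]
      exact (ih fun x hx => hD (Finset.mem_insert_of_mem hx)).trans
        (sum_powerset_le_insert p g hg (fun e he => h0 e (hsub he)) fun e he => h1 e (hsub he))
  have h := key F subset_rfl
  rwa [Finset.union_eq_left.2 hEF] at h

/-! ### Expected spread and the expected cost of an RR set. -/

namespace ProbGraph

variable {V : Type u}

theorem Reach.mono {φ ψ : Finset (V × V)} (h : φ ⊆ ψ) {w v : V} (hr : Reach φ w v) :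
    Reach ψ w v :=
  Relation.ReflTransGen.mono (fun _ _ hab => h hab) _ _ hr

/-- `H` is a subgraph of `G` with the same propagation probabilities. -/
structure Subgraph (H G : ProbGraph V) : Prop where
  nodes : H.nodes ⊆ G.nodes
  edges : H.edges ⊆ G.edges
  p : H.p = G.p

theorem Subgraph.refl (G : ProbGraph V) : Subgraph G G := ⟨subset_rfl, subset_rfl, rfl⟩

theorem Subgraph.remove {H G : ProbGraph V} (h : Subgraph H G) (A : Finset V) :
    Subgraph (H.remove A) G := by
  classical
  exact ⟨Finset.sdiff_subset.trans h.nodes, (Finset.filter_subset _ _).trans h.edges, h.p⟩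

theorem card_activated_mono (G : ProbGraph V) (S : Finset V) :
    Monotone fun φ : Finset (V × V) => ((G.activated φ S).card : ℝ) := by
  intro φ ψ h
  simp only [Nat.cast_le]
  refine Finset.card_le_card fun v hv => ?_
  simp only [activated, Finset.mem_filter] at hv ⊢
  exact ⟨hv.1, hv.2.imp fun s hs => ⟨hs.1, hs.2.mono h⟩⟩

/-- Two separate enlargements: counting activated nodes in `G.nodes` for the same live edges, then
adding the missing edges, which can only activate more. -/
theorem Subgraph.expectedSpread_le {H G : ProbGraph V} (h : Subgraph H G) (S : Finset V) :
    H.expectedSpread S ≤ G.expectedSpread S := by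
  classical
  have h1 : H.expectedSpread S ≤
      ∑ φ ∈ H.edges.powerset, ((G.activated φ S).card : ℝ) * H.realizationProb φ := by
    refine Finset.sum_le_sum fun φ hφ => mul_le_mul_of_nonneg_right ?_
      (H.realizationProb_nonneg (Finset.mem_powerset.1 hφ))
    exact_mod_cast Finset.card_le_card (Finset.filter_subset_filter _ h.nodes)
  refine h1.trans ?_
  have h2 := sum_powerset_mono G.p _ (G.card_activated_mono S) h.edges
    (fun e he => (G.p_pos e he).le) G.p_le_one
  unfold expectedSpread realizationProb
  rw [h.p]
  convert h2

theorem one_le_expectedSpread (G : ProbGraph V) {v : V} (hv : v ∈ G.nodes) :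
    1 ≤ G.expectedSpread {v} := by
  rw [← G.sum_realizationProb]
  refine Finset.sum_le_sum fun φ hφ =>
    le_mul_of_one_le_left (G.realizationProb_nonneg (Finset.mem_powerset.1 hφ)) ?_
  have : 0 < (G.activated φ {v}).card := by
    classical
    exact Finset.card_pos.2
      ⟨v, Finset.mem_filter.2 ⟨hv, v, Finset.mem_singleton_self v, .refl⟩⟩
  exact_mod_cast this

theorem tsum_realization_mul_card (G : ProbGraph V) (S : Finset V) :
    ∑' φ, G.realization φ * ((G.activated φ S).card : ℝ≥0∞) =
      ENNReal.ofReal (G.expectedSpread S) := by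
  classical
  rw [tsum_eq_sum (s := G.edges.powerset), expectedSpread, ENNReal.ofReal_sum_of_nonneg]
  · refine Finset.sum_congr rfl fun φ hφ => ?_
    rw [realization, PMF.ofFinset_apply, if_pos (Finset.mem_powerset.1 hφ), mul_comm,
      ENNReal.ofReal_mul (Nat.cast_nonneg _), ENNReal.ofReal_natCast]
  · exact fun φ hφ => mul_nonneg (Nat.cast_nonneg _)
      (G.realizationProb_nonneg (Finset.mem_powerset.1 hφ))
  · intro φ hφ
    rw [realization, PMF.ofFinset_apply, if_neg fun h => hφ (Finset.mem_powerset.2 h), zero_mul]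

open scoped Classical in
/-- The expected time of one RR set is the sum of the expected spreads of all nodes and of the
heads of all edges, divided by the number of nodes. -/
theorem tsum_rrSet_mul_rrTime (G : ProbGraph V) (h : G.nodes.Nonempty) :
    ∑' R, G.rrSet R * (G.rrTime R : ℝ≥0∞) =
      (G.nodes.card : ℝ≥0∞)⁻¹ *
        (∑ v ∈ G.nodes, 2 * ENNReal.ofReal (G.expectedSpread {v}) +
          ∑ e ∈ G.edges, ENNReal.ofReal (G.expectedSpread {e.2})) := by
  have hcard : ∀ (φ : Finset (V × V)) (v : V),
      ((G.activated φ {v}).card : ℝ≥0∞) = ∑ r ∈ G.nodes, if Reach φ v r then 1 else 0 := by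
    intro φ v
    simp [activated, Finset.sum_boole]
  -- The cost becomes a sum of indicators of `Reach φ v r`. Summed over the roots `r`, they count
  -- the nodes activated by `v`, so exchanging the sums turns RR sets into spreads.
  have htime : ∀ (φ : Finset (V × V)) (r : V),
      (G.rrTime (G.nodes.filter fun v => Reach φ v r) : ℝ≥0∞) =
        ∑ v ∈ G.nodes, 2 * (if Reach φ v r then 1 else 0) +
          ∑ e ∈ G.edges, if Reach φ e.2 r then 1 else 0 := by
    intro φ r
    have hw : G.width (G.nodes.filter fun v => Reach φ v r) =
        (G.edges.filter fun e => Reach φ e.2 r).card := by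
      unfold width
      congr 1
      refine Finset.filter_congr fun e he => ?_
      simp [(G.edges_mem e he).2]
    rw [rrTime, hw, ← Finset.mul_sum, Finset.sum_boole, Finset.sum_boole]
    push_cast
    ring
  have hu : ∀ f : V → ℝ≥0∞, ∑' r, PMF.uniformOfFinset G.nodes h r * f r =
      (G.nodes.card : ℝ≥0∞)⁻¹ * ∑ r ∈ G.nodes, f r := by
    intro f
    rw [tsum_eq_sum (s := G.nodes), Finset.mul_sum]
    · refine Finset.sum_congr rfl fun r hr => ?_
      rw [PMF.uniformOfFinset_apply_of_mem h hr]
    · intro r hr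
      rw [PMF.uniformOfFinset_apply_of_notMem h hr, zero_mul]
  rw [rrSet, dif_pos h, tsum_bind_mul, hu]
  congr 1
  simp only [tsum_map_mul, htime, tsum_mul_add, Finset.sum_add_distrib,
    ← tsum_realization_mul_card, hcard]
  simp only [Finset.mul_sum, ← ENNReal.tsum_mul_left,
    Summable.tsum_finsetSum fun _ _ => ENNReal.summable]
  congr 1
  · rw [Finset.sum_comm]
    simp only [mul_left_comm]
  · rw [Finset.sum_comm]

theorem Subgraph.tsum_rrSet_mul_rrTime_le {H G : ProbGraph V} (hs : Subgraph H G) {σ : ℝ}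
    (hσ : ∀ v ∈ G.nodes, G.expectedSpread {v} ≤ σ) (h : H.nodes.Nonempty) :
    ∑' R, H.rrSet R * (H.rrTime R : ℝ≥0∞) ≤
      ENNReal.ofReal ((2 * G.nodes.card + G.edges.card) * σ / H.nodes.card) := by
  have hpos : (0 : ℝ) < H.nodes.card := by exact_mod_cast h.card_pos
  have hle : ∀ v ∈ H.nodes, ENNReal.ofReal (H.expectedSpread {v}) ≤ ENNReal.ofReal σ :=
    fun v hv => ENNReal.ofReal_le_ofReal ((hs.expectedSpread_le _).trans (hσ v (hs.nodes hv)))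
  have h1 : (∑ v ∈ H.nodes, 2 * ENNReal.ofReal (H.expectedSpread {v}) +
          ∑ e ∈ H.edges, ENNReal.ofReal (H.expectedSpread {e.2})) ≤
      ENNReal.ofReal ((2 * G.nodes.card + G.edges.card) * σ) := by
    have h2 : (∑ v ∈ H.nodes, 2 * ENNReal.ofReal (H.expectedSpread {v}) +
          ∑ e ∈ H.edges, ENNReal.ofReal (H.expectedSpread {e.2})) ≤
        ∑ v ∈ H.nodes, 2 * ENNReal.ofReal σ + ∑ e ∈ H.edges, ENNReal.ofReal σ :=
      add_le_add (Finset.sum_le_sum fun v hv => mul_le_mul_right (hle v hv) _)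
        (Finset.sum_le_sum fun e he => hle _ (H.edges_mem e he).2)
    refine h2.trans ?_
    rw [Finset.sum_const, Finset.sum_const, nsmul_eq_mul, nsmul_eq_mul, ← mul_assoc, ← add_mul,
      ENNReal.ofReal_mul (by positivity)]
    refine mul_le_mul_left ?_ _
    rw [ENNReal.ofReal_add (by positivity) (by positivity), ENNReal.ofReal_mul (by positivity),
      ENNReal.ofReal_natCast, ENNReal.ofReal_natCast, ENNReal.ofReal_ofNat, mul_comm]
    have hn : (H.nodes.card : ℝ≥0∞) ≤ G.nodes.card := by
      exact_mod_cast Finset.card_le_card hs.nodes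
    have he : (H.edges.card : ℝ≥0∞) ≤ G.edges.card := by
      exact_mod_cast Finset.card_le_card hs.edges
    gcongr
  rw [H.tsum_rrSet_mul_rrTime h, div_eq_inv_mul, ENNReal.ofReal_mul (by positivity),
    ENNReal.ofReal_inv_of_pos hpos, ENNReal.ofReal_natCast]
  exact mul_le_mul_right h1 _

theorem tsum_rrSets_mul_sum (G : ProbGraph V) (f : Finset V → ℕ) (θ : ℕ) :
    ∑' L, G.rrSets θ L * (((L.map f).sum : ℕ) : ℝ≥0∞) =
      θ * ∑' R, G.rrSet R * (f R : ℝ≥0∞) := by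
  induction θ with
  | zero => simp [rrSets]
  | succ θ ih =>
    simp only [rrSets, tsum_bind_mul, tsum_map_mul, List.map_cons, List.sum_cons, Nat.cast_add,
      tsum_mul_add, tsum_mul_const, ih]
    push_cast
    ring

end ProbGraph

/-! ### The error schedule and the sample size. -/

namespace Input

variable {V : Type u}

/-- The invariant of the errors during the rounds on a residual graph with `ν` nodes. -/
structure RoundInvariant (I : Input V) (ν : ℕ) (εi ζi δi : ℝ) : Prop where
  half_lt_eps : I.ε / 2 < εi
  eps_le_one : εi ≤ 1
  half_lt_zeta : 1 / 2 < ν * ζi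
  zeta_le_one : ζi ≤ 1
  -- The product of the errors and `δi` are halved together, so this survives from the start, where
  -- the product is at most `1`. It bounds `δi` below without counting rounds.
  delta : εi * ζi / (I.k * I.n) ≤ δi

namespace RoundInvariant

variable {I : Input V} {ν : ℕ} {εi ζi δi : ℝ}

theorem eps_pos (h : I.RoundInvariant ν εi ζi δi) (hε : 0 < I.ε) : 0 < εi := by
  linarith [h.half_lt_eps]

theorem zeta_pos (h : I.RoundInvariant ν εi ζi δi) : 0 < ζi := by
  by_contra hz
  nlinarith [h.half_lt_zeta, mul_nonneg (Nat.cast_nonneg (α := ℝ) ν) (sub_nonneg.2 (not_lt.1 hz))]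

theorem card_pos (h : I.RoundInvariant ν εi ζi δi) : (0 : ℝ) < ν := by
  by_contra hz
  nlinarith [h.half_lt_zeta, h.zeta_pos, not_lt.1 hz]

theorem eps_lt (h : I.RoundInvariant ν εi ζi δi) (hε : 0 < I.ε) :
    I.ε < 4 * ν * (εi * ζi) := by
  nlinarith [h.half_lt_eps, h.half_lt_zeta, h.eps_pos hε]

theorem inv_lt (h : I.RoundInvariant ν εi ζi δi) (hε : 0 < I.ε) :
    1 / (εi * ζi) < 4 * ν / I.ε := by
  rw [div_lt_div_iff₀ (mul_pos (h.eps_pos hε) h.zeta_pos) hε]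
  linarith [h.eps_lt hε]

/-- An inconclusive round halves the product of the errors and keeps the invariant. -/
theorem adjust (h : I.RoundInvariant ν εi ζi δi) (hε : 0 < I.ε)
    (hcont : ¬ (εi ≤ I.ε ∧ ν * ζi ≤ 1)) (f : ℝ) :
    (I.adjust ν f εi ζi).1 * (I.adjust ν f εi ζi).2 = εi * ζi / 2 ∧
      I.RoundInvariant ν (I.adjust ν f εi ζi).1 (I.adjust ν f εi ζi).2 (δi / 2) := by
  have hεi := h.eps_pos hε
  have hζi := h.zeta_pos
  have hsq : √2 * √2 = (2 : ℝ) := Real.mul_self_sqrt (by norm_num)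
  have hs2 : √2 < (2 : ℝ) := by nlinarith [Real.sqrt_nonneg 2]
  have hs1 : 1 ≤ √2 := by nlinarith [Real.sqrt_nonneg 2]
  have hprod : (I.adjust ν f εi ζi).1 * (I.adjust ν f εi ζi).2 = εi * ζi / 2 := by
    unfold Input.adjust
    split_ifs
    · simp only; ring
    · simp only; ring
    · simp only; ring
    · simp only; ring
    · simp only
      rw [div_mul_div_comm, hsq]
  have hδ : (I.adjust ν f εi ζi).1 * (I.adjust ν f εi ζi).2 / (I.k * I.n) ≤ δi / 2 := by
    rw [hprod, div_right_comm]
    linarith [h.delta]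
  have hεhalf := h.half_lt_eps
  have hζhalf := h.half_lt_zeta
  have hεone := h.eps_le_one
  have hζone := h.zeta_le_one
  have hε2 : I.ε < εi → I.ε / 2 < εi / √2 := fun hlt => by
    rw [div_lt_div_iff₀ two_pos (by linarith)]
    nlinarith
  have hζ2 : 1 < ν * ζi → 1 / 2 < ν * (ζi / √2) := fun hlt => by
    rw [← mul_div_assoc, div_lt_div_iff₀ two_pos (by linarith)]
    linarith
  have hd : ∀ x : ℝ, 0 < x → x ≤ 1 → x / √2 ≤ 1 := fun x h0 h1 =>
    (div_le_one (by linarith)).2 (h1.trans hs1)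
  refine ⟨hprod, ?_⟩
  unfold Input.adjust at hδ ⊢
  split_ifs at hδ ⊢ with h1 h2 h3 h4
  · exact ⟨hεhalf, hεone, by simp only; linarith, by simp only; linarith, hδ⟩
  · exact ⟨by simp only; linarith, by simp only; linarith, hζhalf, hζone, hδ⟩
  all_goals
    -- In the last three cases both errors are strictly above their thresholds, since the first two
    -- cases and `C₂'` have failed. So halving either one, or dividing both by `√2 < 2`, is safe.
    have hεlt : I.ε < εi := by
      by_contra hc
      exact h1 ⟨not_lt.1 hc, lt_of_not_ge fun hle => hcont ⟨not_lt.1 hc, hle⟩⟩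
    have hζlt : 1 < ν * ζi := lt_of_not_ge fun hle => h2 ⟨hεlt, hle⟩
  · exact ⟨by simp only; linarith, by simp only; linarith, hζhalf, hζone, hδ⟩
  · exact ⟨hεhalf, hεone, by simp only; linarith, by simp only; linarith, hδ⟩
  · exact ⟨hε2 hεlt, hd _ hεi hεone, hζ2 hζlt, hd _ hζi hζone, hδ⟩

end RoundInvariant

/-- An upper bound of `ln (4 / δ)` over all rounds. -/
noncomputable def logBound (I : Input V) : ℝ := Real.log (16 * I.n ^ 3 / I.ε)

/-- With `x = εi * ζi`, the invariant gives `4 / δi ≤ 4 * k * n / x` and `1 / x < 4 * ν / ε`; then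
`k` and `ν` are bounded by `n`. -/
theorem RoundInvariant.log_le {I : Input V} {ν : ℕ} {εi ζi δi : ℝ}
    (h : I.RoundInvariant ν εi ζi δi) (hε : 0 < I.ε) (hν : ν ≤ I.n) (hk0 : 0 < I.k)
    (hk : I.k ≤ I.n) : Real.log (4 / δi) ≤ I.logBound := by
  have hx : 0 < εi * ζi := mul_pos (h.eps_pos hε) h.zeta_pos
  have hk0' : (0 : ℝ) < I.k := by exact_mod_cast hk0
  have hk' : (I.k : ℝ) ≤ I.n := by exact_mod_cast hk
  have hν' : (ν : ℝ) ≤ I.n := by exact_mod_cast hν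
  have hn : (0 : ℝ) < I.n := hk0'.trans_le hk'
  have hkn : (0 : ℝ) < I.k * I.n := mul_pos hk0' hn
  have hδ : 0 < δi := (div_pos hx hkn).trans_le h.delta
  refine Real.log_le_log (by positivity) ?_
  rw [div_le_div_iff₀ hδ hε]
  have h1 : εi * ζi ≤ δi * (I.k * I.n) := (div_le_iff₀ hkn).1 h.delta
  calc 4 * I.ε ≤ 4 * (4 * ν * (εi * ζi)) := by linarith [h.eps_lt hε]
    _ ≤ 4 * (4 * I.n * (δi * (I.n * I.n))) := by
      have h2 : εi * ζi ≤ δi * (I.n * I.n) := h1.trans (by gcongr)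
      exact mul_le_mul_of_nonneg_left (mul_le_mul (by linarith) h2 hx.le (by positivity))
        (by norm_num)
    _ = 16 * I.n ^ 3 * δi := by ring

/-- Since `εi ≤ 1`, the factor `(1 + εi / 3) ^ 2 / 2` is at most `1`. The rounding error of the
ceiling is absorbed by `1 ≤ 1 / (εi * ζi)`. -/
theorem RoundInvariant.sampleSize_le {I : Input V} {ν : ℕ} {εi ζi δi : ℝ}
    (h : I.RoundInvariant ν εi ζi δi) (hε : 0 < I.ε) (hν : ν ≤ I.n) (hk0 : 0 < I.k)
    (hk : I.k ≤ I.n) (hL : 0 ≤ I.logBound) :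
    (sampleSize εi ζi δi : ℝ) ≤ (I.logBound + 1) / (εi * ζi) := by
  have hεi := h.eps_pos hε
  have hζi := h.zeta_pos
  have hx : 0 < εi * ζi := mul_pos hεi hζi
  have hx1 : εi * ζi ≤ 1 := mul_le_one₀ h.eps_le_one hζi.le h.zeta_le_one
  have h1 : (1 + εi / 3) ^ 2 / (2 * εi * ζi) * Real.log (4 / δi) ≤ I.logBound / (εi * ζi) := by
    have hc : (1 + εi / 3) ^ 2 / (2 * εi * ζi) ≤ 1 / (εi * ζi) := by
      rw [div_le_div_iff₀ (by positivity) hx]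
      have : (1 + εi / 3) ^ 2 ≤ 2 := by nlinarith [h.eps_le_one]
      nlinarith
    calc _ ≤ (1 + εi / 3) ^ 2 / (2 * εi * ζi) * I.logBound :=
          mul_le_mul_of_nonneg_left (h.log_le hε hν hk0 hk) (by positivity)
      _ ≤ 1 / (εi * ζi) * I.logBound := mul_le_mul_of_nonneg_right hc hL
      _ = _ := by ring
  have h2 : (sampleSize εi ζi δi : ℝ) ≤ ⌈I.logBound / (εi * ζi)⌉₊ := by
    exact_mod_cast Nat.ceil_mono h1
  have h3 := (Nat.ceil_lt_add_one (div_nonneg hL hx.le)).le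
  have h4 : 1 ≤ 1 / (εi * ζi) := (one_le_div hx).2 hx1
  rw [add_div]
  linarith

/-! ### Recursion for the expected time. -/

theorem expectedTimeUpTo_done (I : Input V) (φ : Finset (V × V)) (S : Finset V) (t : ℕ) :
    I.expectedTimeUpTo φ t (.done S) = 0 := by
  induction t with
  | zero => rfl
  | succ t ih => simp [expectedTimeUpTo, step, ih]

/-- Once the remaining cost is bounded by a `B` that does not depend on the samples, only the mean
sampling cost is left, so the correlation between the samples and the outcome of the round plays no
role. -/
theorem tsum_step_round_le (I : Input V) (φ : Finset (V × V)) (G : ProbGraph V) (S T : Finset V)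
    (v : V) (us : List V) (εi ζi δi : ℝ) (g : Config V → ℝ≥0∞) (B : ℝ≥0∞)
    (hB : ∀ R₁ R₂, ((I.finishRound φ G S T v us εi ζi δi (sampleSize εi ζi δi) R₁ R₂).2 : ℝ≥0∞) +
      g (I.finishRound φ G S T v us εi ζi δi (sampleSize εi ζi δi) R₁ R₂).1 ≤
        ((1 + ((R₁ ++ R₂).map G.rrTime).sum : ℕ) : ℝ≥0∞) + B) :
    ∑' y, I.step φ (.round G S T v us εi ζi δi) y * ((y.2 : ℝ≥0∞) + g y.1) ≤
      1 + 2 * (sampleSize εi ζi δi * ∑' R, G.rrSet R * (G.rrTime R : ℝ≥0∞)) + B := by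
  simp only [step, tsum_bind_mul, tsum_map_mul]
  refine (tsum_mul_mono _ fun R₁ => tsum_mul_mono _ fun R₂ => hB R₁ R₂).trans (le_of_eq ?_)
  simp only [List.map_append, List.sum_append, Nat.cast_add, tsum_mul_add, tsum_mul_const,
    ProbGraph.tsum_rrSets_mul_sum]
  push_cast
  ring

open scoped Classical in
theorem finishRound_add_le (I : Input V) (φ : Finset (V × V)) (G : ProbGraph V)
    (S T : Finset V) (v : V) (us : List V) (εi ζi δi : ℝ) (θ : ℕ) (R₁ R₂ : List (Finset V))
    (g : Config V → ℝ≥0∞) (B : ℝ≥0∞)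
    (hsel : ((G.nodes.card + G.edges.card : ℕ) : ℝ≥0∞) +
      g (.next (G.remove (G.activated (φ ∩ G.edges) {v})) (insert v S) T us) ≤ B)
    (hrej : g (.next G S (T.erase v) us) ≤ B)
    (hcont : ∀ f, ¬ (εi ≤ I.ε ∧ G.nodes.card * ζi ≤ 1) →
      g (.round G S T v us (I.adjust G.nodes.card f εi ζi).1 (I.adjust G.nodes.card f εi ζi).2
        (δi / 2)) ≤ B) :
    ((I.finishRound φ G S T v us εi ζi δi θ R₁ R₂).2 : ℝ≥0∞) +
      g (I.finishRound φ G S T v us εi ζi δi θ R₁ R₂).1 ≤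
        ((1 + ((R₁ ++ R₂).map G.rrTime).sum : ℕ) : ℝ≥0∞) + B := by
  unfold finishRound
  simp only
  split_ifs with h1 h2
  · rw [Nat.cast_add, add_assoc]
    exact add_le_add_right hsel _
  · exact add_le_add_right hrej _
  · exact add_le_add_right (hcont _ fun h => h1 (Or.inr h)) _

/-- A bound of the expected time of one iteration of the `for` loop, where `σ` bounds the expected
spread of every node. -/
noncomputable def passBound (I : Input V) (σ : ℝ) : ℝ :=
  1 + (8 * I.n + 16 * (I.logBound + 1) * ((2 * I.n + I.m) * σ)) / I.ε + (I.n + I.m)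

/-- The bound of the expected time of the rounds that start with the product `x` of the errors on
a residual graph with `ν` nodes. -/
noncomputable def roundBound (I : Input V) (σ ν x : ℝ) : ℝ :=
  (1 + 2 * (I.logBound + 1) * ((2 * I.n + I.m) * σ / ν)) * (8 * ν / I.ε - 1 / x)

/-- Induction on the number of steps, with bounds independent of it, so that they pass to the
supremum. In the second bound, `n + m` is reserved for one rebuild of the graph and the final `1`
for the return. -/
theorem expectedTimeUpTo_le (I : Input V) (φ : Finset (V × V)) {σ : ℝ} (hσ0 : 0 ≤ σ)
    (hσ : ∀ v ∈ I.graph.nodes, I.graph.expectedSpread {v} ≤ σ)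
    (hε : 0 < I.ε) (hε₀ : I.ε ≤ I.ε₀) (hε₁ : I.ε₀ ≤ 1)
    (hζ : ∀ ν : ℕ, 1 ≤ ν → ν ≤ I.n → 1 / (ν : ℝ) ≤ I.ζ₀ ν ∧ I.ζ₀ ν ≤ 1)
    (hk0 : 0 < I.k) (hk : I.k ≤ I.n) (hL : 0 ≤ I.logBound) (t : ℕ) :
    (∀ G S T us, G.Subgraph I.graph →
      I.expectedTimeUpTo φ t (.next G S T us) ≤
        ENNReal.ofReal (us.length * I.passBound σ + 1)) ∧
    ∀ G S T v us εi ζi δi, G.Subgraph I.graph → I.RoundInvariant G.nodes.card εi ζi δi →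
      I.expectedTimeUpTo φ t (.round G S T v us εi ζi δi) ≤
        ENNReal.ofReal (I.roundBound σ G.nodes.card (εi * ζi) + (I.n + I.m) +
          (us.length * I.passBound σ + 1)) := by
  have hP : 0 ≤ I.passBound σ := by
    unfold passBound
    positivity
  have hcard : ∀ {G : ProbGraph V}, G.Subgraph I.graph → G.nodes.card ≤ I.n :=
    fun h => Finset.card_le_card h.nodes
  have hcard' : ∀ {G : ProbGraph V}, G.Subgraph I.graph → G.edges.card ≤ I.m :=
    fun h => Finset.card_le_card h.edges
  induction t with
  | zero => exact ⟨fun _ _ _ _ _ => zero_le, fun _ _ _ _ _ _ _ _ _ _ => zero_le⟩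
  | succ t ih =>
    constructor
    · intro G S T us hG
      cases us with
      | nil =>
        simp [expectedTimeUpTo, step, expectedTimeUpTo_done]
      | cons v us =>
        have hcons : (((v :: us).length : ℕ) : ℝ) * I.passBound σ + 1 =
            I.passBound σ + (us.length * I.passBound σ + 1) := by
          push_cast [List.length_cons]
          ring
        have hone : ∀ b : ℝ, 0 ≤ b → ((1 : ℕ) : ℝ≥0∞) + ENNReal.ofReal b =
            ENNReal.ofReal (1 + b) := fun b hb => by
          rw [ENNReal.ofReal_add one_pos.le hb]
          simp
        rw [hcons]
        simp only [expectedTimeUpTo, step]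
        split_ifs with hv
        · have hne : G.nodes.Nonempty := ⟨v, hv⟩
          have hν : (0 : ℝ) < G.nodes.card := by exact_mod_cast hne.card_pos
          obtain ⟨hz1, hz2⟩ := hζ _ hne.card_pos (hcard hG)
          have hz : 1 ≤ G.nodes.card * I.ζ₀ G.nodes.card := by
            rwa [div_le_iff₀' hν] at hz1
          have hz0 : 0 < I.ζ₀ G.nodes.card := (by positivity : (0 : ℝ) < 1 / _).trans_le hz1
          have he0 : 0 < I.ε₀ := hε.trans_le hε₀
          have hinv : I.RoundInvariant G.nodes.card I.ε₀ (I.ζ₀ G.nodes.card)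
              (1 / (I.k * I.n)) :=
            ⟨by linarith, hε₁, by linarith, hz2, div_le_div_of_nonneg_right
              (mul_le_one₀ hε₁ hz0.le hz2) (by positivity)⟩
          have hx := mul_pos he0 hz0
          have hA : I.roundBound σ G.nodes.card (I.ε₀ * I.ζ₀ G.nodes.card) ≤
              (8 * I.n + 16 * (I.logBound + 1) * ((2 * I.n + I.m) * σ)) / I.ε := by
            have hνn : (G.nodes.card : ℝ) ≤ I.n := by exact_mod_cast hcard hG
            -- Dropping `- 1 / x` leaves `8 * ν / ε`, whose `ν` cancels the denominator of the
            -- RR-set cost.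
            calc I.roundBound σ G.nodes.card (I.ε₀ * I.ζ₀ G.nodes.card)
                ≤ (1 + 2 * (I.logBound + 1) * ((2 * I.n + I.m) * σ / G.nodes.card)) *
                    (8 * G.nodes.card / I.ε) :=
                  mul_le_mul_of_nonneg_left (sub_le_self _ (by positivity)) (by positivity)
              _ = (8 * G.nodes.card + 16 * (I.logBound + 1) * ((2 * I.n + I.m) * σ)) / I.ε := by
                  field_simp
                  ring
              _ ≤ _ := by gcongr
          have hA0 : 0 ≤ I.roundBound σ G.nodes.card (I.ε₀ * I.ζ₀ G.nodes.card) := by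
            refine mul_nonneg (by positivity) (sub_nonneg.2 ((hinv.inv_lt hε).le.trans ?_))
            gcongr
            norm_num
          rw [tsum_pure_mul]
          refine (add_le_add_right (ih.2 _ _ _ _ _ _ _ _ hG hinv) _).trans ?_
          rw [hone _ (by positivity)]
          refine ENNReal.ofReal_le_ofReal ?_
          unfold passBound
          unfold passBound at hP
          linarith
        · rw [tsum_pure_mul]
          refine (add_le_add_right (ih.1 _ _ _ _ hG) _).trans ?_
          rw [hone _ (by positivity)]
          refine ENNReal.ofReal_le_ofReal (add_le_add_left ?_ _)
          unfold passBound
          rw [add_assoc]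
          exact le_add_of_nonneg_right (by positivity)
    · intro G S T v us εi ζi δi hG hinv
      have hx : 0 < εi * ζi := mul_pos (hinv.eps_pos hε) hinv.zeta_pos
      have hν := hinv.card_pos
      have hne : G.nodes.Nonempty := Finset.card_pos.1 (by exact_mod_cast hν)
      set x := εi * ζi with hxdef
      set ν : ℝ := (G.nodes.card : ℝ) with hνdef
      set D : ℝ := (2 * I.n + I.m) * σ with hD
      set B : ℝ := I.roundBound σ ν (x / 2) + (I.n + I.m) + (us.length * I.passBound σ + 1)
        with hBdef
      -- The potential after the round must be nonnegative even when the round ends the iteration.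
      -- The invariant at `x` gives `1 / (x / 2) < 8 * ν / ε`, whence the `8` in `roundBound`.
      have hA0 : 0 ≤ I.roundBound σ ν (x / 2) := by
        refine mul_nonneg (by positivity) (sub_nonneg.2 ?_)
        have h1 := hinv.inv_lt hε
        have h2 : 1 / (x / 2) = 2 * (1 / x) := by field_simp
        have h3 : 8 * ν / I.ε = 2 * (4 * ν / I.ε) := by ring
        rw [h2, h3]
        linarith
      have hnext : (0 : ℝ) ≤ us.length * I.passBound σ + 1 := by positivity
      have hnm : (0 : ℝ) ≤ I.n + I.m := by positivity
      have hB0 : 0 ≤ B := by linarith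
      have hfin : ∀ R₁ R₂, _ := fun R₁ R₂ =>
        I.finishRound_add_le φ G S T v us εi ζi δi (sampleSize εi ζi δi) R₁ R₂
          (I.expectedTimeUpTo φ t) (ENNReal.ofReal B)
          (by
            refine (add_le_add_right (ih.1 _ _ _ _ (hG.remove _)) _).trans ?_
            rw [← ENNReal.ofReal_natCast, ← ENNReal.ofReal_add (Nat.cast_nonneg _) hnext]
            refine ENNReal.ofReal_le_ofReal ?_
            have h1 : (G.nodes.card : ℝ) ≤ I.n := by exact_mod_cast hcard hG
            have h2 : (G.edges.card : ℝ) ≤ I.m := by exact_mod_cast hcard' hG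
            push_cast
            linarith)
          ((ih.1 _ _ _ _ hG).trans (ENNReal.ofReal_le_ofReal (by linarith)))
          (fun f hf => by
            obtain ⟨hp, hi⟩ := hinv.adjust hε hf f
            refine (ih.2 _ _ _ _ _ _ _ _ hG hi).trans (le_of_eq ?_)
            rw [hp])
      refine (I.tsum_step_round_le φ G S T v us εi ζi δi _ _ hfin).trans ?_
      have hθ := hinv.sampleSize_le hε (hcard hG) hk0 hk hL
      have hR := hG.tsum_rrSet_mul_rrTime_le hσ hne
      calc 1 + 2 * (sampleSize εi ζi δi * ∑' R, G.rrSet R * (G.rrTime R : ℝ≥0∞)) +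
            ENNReal.ofReal B
          ≤ 1 + 2 * (sampleSize εi ζi δi * ENNReal.ofReal (D / ν)) + ENNReal.ofReal B := by
            gcongr
            exact hR
        _ = ENNReal.ofReal (1 + 2 * (sampleSize εi ζi δi * (D / ν)) + B) := by
            rw [ENNReal.ofReal_add (by positivity) hB0,
              ENNReal.ofReal_add one_pos.le (by positivity), ENNReal.ofReal_one,
              ENNReal.ofReal_mul two_pos.le, ENNReal.ofReal_mul (Nat.cast_nonneg _),
              ENNReal.ofReal_natCast, ENNReal.ofReal_ofNat]
        _ ≤ _ := by
            refine ENNReal.ofReal_le_ofReal ?_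
            have hx1 : x ≤ 1 := mul_le_one₀ hinv.eps_le_one hinv.zeta_pos.le hinv.zeta_le_one
            have h1 : 1 ≤ 1 / x := (one_le_div hx).2 hx1
            have h2 : (sampleSize εi ζi δi : ℝ) * (D / ν) ≤
                (I.logBound + 1) / x * (D / ν) :=
              mul_le_mul_of_nonneg_right hθ (by positivity)
            -- Because `1 / (x / 2) - 1 / x = 1 / x`, the drop of the potential is exactly the
            -- sampling bound plus `1 / x`, and `1 / x ≥ 1` pays the unit cost of the round.
            have h3 : I.roundBound σ ν x = I.roundBound σ ν (x / 2) +
                (1 / x + 2 * ((I.logBound + 1) / x * (D / ν))) := by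
              unfold roundBound
              rw [← hD]
              field_simp
              ring
            linarith

theorem expectedTime_le (I : Input V) {σ : ℝ} (hσ0 : 0 ≤ σ)
    (hσ : ∀ v ∈ I.graph.nodes, I.graph.expectedSpread {v} ≤ σ)
    (hε : 0 < I.ε) (hε₀ : I.ε ≤ I.ε₀) (hε₁ : I.ε₀ ≤ 1)
    (hζ : ∀ ν : ℕ, 1 ≤ ν → ν ≤ I.n → 1 / (ν : ℝ) ≤ I.ζ₀ ν ∧ I.ζ₀ ν ≤ 1)
    (hk0 : 0 < I.k) (hk : I.k ≤ I.n) (hL : 0 ≤ I.logBound) :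
    I.expectedTime ≤ ENNReal.ofReal (I.n + I.m + (I.k * I.passBound σ + 1)) := by
  have hP : 0 ≤ I.passBound σ := by
    unfold passBound
    positivity
  rw [ENNReal.ofReal_add (by positivity) (by positivity), ← Nat.cast_add, ENNReal.ofReal_natCast]
  refine add_le_add_right ?_ _
  refine (tsum_mul_mono _ fun φ => iSup_le fun t => (I.expectedTimeUpTo_le φ hσ0 hσ hε hε₀ hε₁ hζ
    hk0 hk hL t).1 _ _ _ _ (ProbGraph.Subgraph.refl _)).trans ?_
  rw [tsum_mul_const]
  rfl

end Input

end HATP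

/-! ### Collecting the constants. -/

theorem mainTheorem6 (a : ℝ) :
    ∃ C : ℝ, 0 < C ∧
      ∀ (V : Type u) (I : HATP.Input V) (v₀ : V),
        2 ≤ I.n →
        (I.n : ℝ) ≤ a * I.m →
        I.targets ≠ [] →
        I.targets.Nodup →
        (∀ v ∈ I.targets, v ∈ I.graph.nodes) →
        0 < I.ε → I.ε < 1 →
        I.ε ≤ I.ε₀ → I.ε₀ ≤ 1 →
        (∀ ν : ℕ, 1 ≤ ν → ν ≤ I.n → 1 / (ν : ℝ) ≤ I.ζ₀ ν ∧ I.ζ₀ ν ≤ 1) →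
        v₀ ∈ I.graph.nodes →
        (∀ v ∈ I.graph.nodes, I.graph.expectedSpread {v} ≤ I.graph.expectedSpread {v₀}) →
        I.expectedTime ≤
          ENNReal.ofReal (C * ((I.k * I.m * I.graph.expectedSpread {v₀} / I.ε) *
            Real.log (I.n / I.ε))) := by
  -- With `X` the target expression without its constant, the terms of the bound give `2 + 16 + 288
  -- + 2 = 308` for `|a| * X` and `2 + 2 + 144 + 2 + 2 = 152` for `X`. The absolute value keeps the
  -- constant positive for every `a`.
  refine ⟨308 * |a| + 152, by positivity, ?_⟩
  intro V I v₀ hn hnm hne hnd hmem hε hε1 hε₀ hε₁ hζ hv₀ hmax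
  classical
  have hk0 : 0 < I.k := List.length_pos_iff.2 hne
  have hk : I.k ≤ I.n := by
    have h : I.targets.toFinset ⊆ I.graph.nodes := fun v hv => hmem v (List.mem_toFinset.1 hv)
    have h2 := Finset.card_le_card h
    rwa [List.toFinset_card_of_nodup hnd] at h2
  have hσ1 : 1 ≤ I.graph.expectedSpread {v₀} := I.graph.one_le_expectedSpread hv₀
  set σ := I.graph.expectedSpread {v₀} with hσdef
  have hσ0 : 0 ≤ σ := one_pos.le.trans hσ1
  have hn' : (2 : ℝ) ≤ I.n := by exact_mod_cast hn
  have hm1 : (1 : ℝ) ≤ I.m := by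
    have : I.m ≠ 0 := fun h => by
      rw [h, Nat.cast_zero, mul_zero] at hnm
      linarith
    exact_mod_cast Nat.one_le_iff_ne_zero.2 this
  have hk1 : (1 : ℝ) ≤ I.k := by exact_mod_cast hk0
  have hb : (I.n : ℝ) ≤ |a| * I.m :=
    hnm.trans (mul_le_mul_of_nonneg_right (le_abs_self a) (by positivity))
  set ℓ := Real.log (I.n / I.ε) with hℓ
  have hnε : (I.n : ℝ) ≤ I.n / I.ε := le_div_self (by positivity) hε hε1.le
  have hℓ2 : 1 / 2 ≤ ℓ := by
    have h1 : Real.log 2 ≤ ℓ := Real.log_le_log two_pos (hn'.trans hnε)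
    linarith [Real.log_two_gt_d9]
  have hL : I.logBound ≤ 7 * ℓ := by
    unfold HATP.Input.logBound
    rw [hℓ, ← Real.log_rpow (by positivity)]
    refine Real.log_le_log (by positivity) ?_
    -- As `n ≥ 2`, the `16` costs four powers of `n`; with `n ^ 3` this makes the exponent `7`.
    have h16 : (16 : ℝ) ≤ I.n ^ 4 := by
      calc (16 : ℝ) = 2 ^ 4 := by norm_num
        _ ≤ _ := by gcongr
    have h1 : (16 * I.n ^ 3 / I.ε : ℝ) ≤ I.n ^ 6 * (I.n / I.ε) := by
      rw [← mul_div_assoc]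
      refine div_le_div_of_nonneg_right ?_ hε.le
      calc (16 * I.n ^ 3 : ℝ) ≤ I.n ^ 4 * I.n ^ 3 := by gcongr
        _ = I.n ^ 6 * I.n := by ring
    refine h1.trans ?_
    calc (I.n ^ 6 * (I.n / I.ε) : ℝ) ≤ (I.n / I.ε) ^ 6 * (I.n / I.ε) := by gcongr
      _ = (I.n / I.ε) ^ (7 : ℝ) := by
        rw [← pow_succ]
        exact_mod_cast (Real.rpow_natCast _ 7).symm
  have hL0 : 0 ≤ I.logBound := by
    refine Real.log_nonneg ((one_le_div hε).2 (hε1.le.trans ?_))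
    have : (1 : ℝ) ≤ I.n ^ 3 := one_le_pow₀ (by linarith)
    linarith
  refine (I.expectedTime_le hσ0 hmax hε hε₀ hε₁ hζ hk0 hk hL0).trans
    (ENNReal.ofReal_le_ofReal ?_)
  have hKm : (I.k * I.m : ℝ) ≤ 2 * (I.k * I.m * σ / I.ε * ℓ) := by
    have h1 : (I.k * I.m : ℝ) ≤ I.k * I.m * σ / I.ε := by
      rw [le_div_iff₀ hε]
      exact mul_le_mul_of_nonneg_left (hε1.le.trans hσ1) (by positivity)
    have h0 : (0 : ℝ) ≤ I.k * I.m * σ / I.ε := by positivity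
    nlinarith
  have hKε : (I.k * I.m / I.ε : ℝ) ≤ 2 * (I.k * I.m * σ / I.ε * ℓ) := by
    have h1 : (I.k * I.m / I.ε : ℝ) ≤ I.k * I.m * σ / I.ε := by
      exact div_le_div_of_nonneg_right (le_mul_of_one_le_right (by positivity) hσ1) hε.le
    have h0 : (0 : ℝ) ≤ I.k * I.m * σ / I.ε := by positivity
    nlinarith
  set X : ℝ := I.k * I.m * σ / I.ε * ℓ with hX
  have hkn : (I.k * I.n : ℝ) ≤ |a| * (I.k * I.m) := by nlinarith
  have e1 : (I.k * I.n : ℝ) ≤ |a| * (2 * X) :=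
    hkn.trans (mul_le_mul_of_nonneg_left hKm (abs_nonneg a))
  have e2 : (I.n : ℝ) ≤ I.k * I.n := le_mul_of_one_le_left (by positivity) hk1
  have e3 : (I.m : ℝ) ≤ I.k * I.m := le_mul_of_one_le_left (by positivity) hk1
  have e4 : (I.k : ℝ) ≤ I.k * I.m := le_mul_of_one_le_right (by positivity) hm1
  have e5 : (I.k * I.n / I.ε : ℝ) ≤ |a| * (2 * X) := by
    calc (I.k * I.n / I.ε : ℝ) ≤ |a| * (I.k * I.m) / I.ε := by gcongr
      _ = |a| * (I.k * I.m / I.ε) := by ring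
      _ ≤ _ := mul_le_mul_of_nonneg_left hKε (abs_nonneg a)
  -- The main term: `logBound + 1 ≤ 7 * ℓ + 2 * ℓ`, by `ℓ ≥ 1 / 2`, and `n ≤ |a| * m`.
  have e6 : I.k * ((I.logBound + 1) * ((2 * I.n + I.m) * σ)) / I.ε ≤
      9 * (2 * |a| + 1) * X := by
    calc I.k * ((I.logBound + 1) * ((2 * I.n + I.m) * σ)) / I.ε
        ≤ I.k * (9 * ℓ * ((2 * (|a| * I.m) + I.m) * σ)) / I.ε := by
          gcongr
          linarith
      _ = 9 * (2 * |a| + 1) * X := by rw [hX]; ring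
  have e7 : (I.k * I.passBound σ : ℝ) = I.k + 8 * (I.k * I.n / I.ε) +
      16 * (I.k * ((I.logBound + 1) * ((2 * I.n + I.m) * σ)) / I.ε) +
        (I.k * I.n + I.k * I.m) := by
    unfold HATP.Input.passBound
    ring
  rw [e7]
  have hX0 : 0 ≤ X := by positivity
  linarith
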